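/- Let $E$ be a real Banach space with dual $E^*$. For $D\subset E^*$ put $\Lambda_D:=\{0\}\cup\{\lambda f:\lambda>0,\ f\in D\}$, and let $L_D:=\{x\in E:\sup_{f\in D}\langle x,f\rangle<0\}$ if $D\neq\emptyset$, while $L_\emptyset:=E\setminus\{0\}$. For a bounded sequence $(x_n)_{n\ge1}$ in $E$ put \[\operatorname{co}_{\sigma_p}\{x_n: n\ge 1\}:=\Big\{\sum_{n=1}^\infty\lambda_nx_n:\ \lambda_n\ge0 \text{ for all } n,\ \sum_{n=1}^\infty\lambda_n=1\Big\}.\] Let $D\subset E^*$ be a weak$^*$-compact convex set with $0\notin D$, let $C\subset E^*$ be a weak$^*$-closed convex set such that $\sup_{c^*\in C}\langle x,c^*\rangle<+\infty$ for every $x\in L_D$, and let $B\subset C$. Assume that $B\neq\emptyset$ or $E\neq\{0\}$. Then the following assertions are equivalent (suprema and infima are taken in $[-\infty,+\infty]$): (i) For every increasing sequence $(K_n)_{n\ge1}$ of weak$^*$-compact convex subsets of $C$ with $B\subset\bigcup_{n=1}^\infty K_n$, one has \[C\subset\overline{\textstyle\bigcup_{n=1}^\infty K_n+\Lambda_D}^{\|\cdot\|}.\]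 (ii) For every bounded sequence $(x_n)_{n\ge1}$ in $L_D$, \[\sup_{b^*\in B}\Big(\limsup_n\langle b^*,x_n\rangle\Big)=\sup_{c^*\in C}\Big(\limsup_n\langle c^*,x_n\rangle\Big).\] (iii) For every bounded sequence $(x_n)_{n\ge1}$ in $L_D$, \[\sup_{b^*\in B}\Big(\limsup_n\langle b^*,x_n\rangle\Big)\ \ge\ \inf_{x\in\operatorname{co}_{\sigma_p}\{x_n:\,n\ge1\}}\ \sup_{c^*\in C}\langle c^*,x\rangle.\] -/

import Mathlib

open Filter Topology
open scoped Pointwise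

noncomputable section

namespace OneSide

variable {E : Type*} [NormedAddCommGroup E] [NormedSpace ℝ E]

/-- A set of functionals is weak*-compact. -/
def IsWeakStarCompact (S : Set (StrongDual ℝ E)) : Prop :=
  IsCompact (StrongDual.toWeakDual '' S)

/-- A set of functionals is weak*-closed. -/
def IsWeakStarClosed (S : Set (StrongDual ℝ E)) : Prop :=
  IsClosed (StrongDual.toWeakDual '' S)

/-- The supremum `sup (x, S)` of the evaluation at `x` over `S`, in the extended reals. -/
def supOn (x : E) (S : Set (StrongDual ℝ E)) : EReal :=
  ⨆ f ∈ S, ((f x : ℝ) : EReal)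

/-- The cone `{0} ∪ {λ f : λ > 0, f ∈ D}` generated by `D`. -/
def cone (D : Set (StrongDual ℝ E)) : Set (StrongDual ℝ E) :=
  {0} ∪ {g | ∃ t : ℝ, 0 < t ∧ ∃ f ∈ D, g = t • f}

/-- The set of directions `L_D`: the `x` with `sup (x, D) < 0` if `D` is nonempty, and all nonzero
vectors if `D` is empty. -/
def directions (D : Set (StrongDual ℝ E)) : Set E :=
  {x | (D.Nonempty ∧ supOn x D < 0) ∨ (D = ∅ ∧ x ≠ 0)}

/-- The infinite convex combinations `∑ λ n • x n` with `λ n ≥ 0` and `∑ λ n = 1`. -/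
def sigmaConvexHull (x : ℕ → E) : Set E :=
  {y | ∃ w : ℕ → ℝ, (∀ n, 0 ≤ w n) ∧ HasSum w 1 ∧ HasSum (fun n => w n • x n) y}

/-- `sup_{f ∈ S} limsup_n f (x n)`, in the extended reals. -/
def supLimsup (x : ℕ → E) (S : Set (StrongDual ℝ E)) : EReal :=
  ⨆ f ∈ S, limsup (fun n => ((f (x n) : ℝ) : EReal)) atTop

end OneSide

end

noncomputable section

namespace OneSide

/-- A function bounded below on a nonempty set has near-minimisers. -/
theorem exists_near_minimizer {α : Type*} {T : Set α} (hT : T.Nonempty) (g : α → ℝ) {m ε : ℝ} (hε : 0 < ε) :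
    ∃ y ∈ T, (∀ y' ∈ T, m ≤ g y') → ∀ y' ∈ T, g y ≤ g y' + ε := by
  by_cases hb : ∀ y' ∈ T, m ≤ g y'
  · obtain ⟨_, ⟨y, hy, rfl⟩, hlt⟩ := Real.lt_sInf_add_pos (hT.image g) hε
    refine ⟨y, hy, fun _ y' hy' => ?_⟩
    have : sInf (g '' T) ≤ g y' :=
      csInf_le ⟨m, by rintro _ ⟨a, ha, rfl⟩; exact hb a ha⟩ ⟨y', hy', rfl⟩
    linarith
  · obtain ⟨y, hy⟩ := hT
    exact ⟨y, hy, fun h => absurd h hb⟩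

variable {E : Type*} [NormedAddCommGroup E] [NormedSpace ℝ E]

/-- The infinite convex combinations of `x` that only use the terms of index at least `k`. -/
def tailHull (x : ℕ → E) (k : ℕ) : Set E :=
  {y | ∃ w : ℕ → ℝ, (∀ n, 0 ≤ w n) ∧ (∀ n < k, w n = 0) ∧ HasSum w 1 ∧
    HasSum (fun n => w n • x n) y}

theorem tailHull_zero (x : ℕ → E) : tailHull x 0 = sigmaConvexHull x := by
  simp [tailHull, sigmaConvexHull]

theorem tailHull_antitone (x : ℕ → E) : Antitone (tailHull x) := by
  rintro k l hkl y ⟨w, h0, hw, h1, hy⟩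
  exact ⟨w, h0, fun n hn => hw n (hn.trans_le hkl), h1, hy⟩

theorem mem_tailHull_self (x : ℕ → E) (k : ℕ) : x k ∈ tailHull x k := by
  refine ⟨Pi.single k 1, fun n => ?_, fun n hn => ?_, hasSum_pi_single k 1, ?_⟩
  · by_cases h : n = k
    · subst h; simp
    · simp [h]
  · simp [hn.ne]
  · convert hasSum_single (f := fun n => (Pi.single k 1 : ℕ → ℝ) n • x n) k ?_ using 1
    · simp
    · intro n hn
      simp [hn]

theorem le_of_mem_tailHull {x : ℕ → E} {k : ℕ} {y : E} (hy : y ∈ tailHull x k)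
    (f : StrongDual ℝ E) {a : ℝ} (h : ∀ n, k ≤ n → f (x n) ≤ a) : f y ≤ a := by
  obtain ⟨w, h0, hw, h1, hy⟩ := hy
  have h2 := f.hasSum hy
  have h3 := h1.mul_right a
  rw [one_mul] at h3
  refine hasSum_le (fun n => ?_) h2 h3
  rcases lt_or_ge n k with hn | hn
  · simp [hw n hn]
  · simpa using mul_le_mul_of_nonneg_left (h n hn) (h0 n)

theorem neg_of_mem_sigmaConvexHull {x : ℕ → E} {y : E} (hy : y ∈ sigmaConvexHull x)
    (f : StrongDual ℝ E) (h : ∀ n, f (x n) < 0) : f y < 0 := by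
  have hle : f y ≤ 0 := by
    rw [← tailHull_zero] at hy
    exact le_of_mem_tailHull hy f fun n _ => (h n).le
  refine lt_of_le_of_ne hle fun h0 => ?_
  obtain ⟨w, hw, h1, hy⟩ := hy
  have h2 := (f.hasSum hy).neg
  rw [h0, neg_zero, hasSum_zero_iff_of_nonneg] at h2
  · have : w = 0 := by
      funext n
      have := congrFun h2 n
      simpa [(h n).ne] using this
    rw [this] at h1
    exact zero_ne_one (hasSum_zero.unique h1)
  · intro n
    have := mul_nonpos_of_nonneg_of_nonpos (hw n) (h n).le
    simpa using this

/-- The tail hulls of a bounded sequence are closed under infinite convex combinations. -/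
theorem exists_hasSum_mem_tailHull {x : ℕ → E} [CompleteSpace E] {M : ℝ} (hM : ∀ n, ‖x n‖ ≤ M)
    {k : ℕ} {Y : ℕ → E} (hY : ∀ j, Y j ∈ tailHull x k) {v : ℕ → ℝ} (hv : ∀ j, 0 ≤ v j)
    (hv1 : HasSum v 1) : ∃ y ∈ tailHull x k, HasSum (fun j => v j • Y j) y := by
  choose w h0 hw h1 hy using hY
  have hF0 : ∀ q : ℕ × ℕ, 0 ≤ v q.1 * w q.1 q.2 := fun q => mul_nonneg (hv _) (h0 _ _)
  have hrow : ∀ j, HasSum (fun n => v j * w j n) (v j) := fun j => by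
    simpa using (h1 j).mul_left (v j)
  have hFs : Summable fun q : ℕ × ℕ => v q.1 * w q.1 q.2 := by
    rw [summable_prod_of_nonneg hF0]
    refine ⟨fun j => (hrow j).summable, ?_⟩
    simpa only [(hrow _).tsum_eq] using hv1.summable
  have hGs : Summable fun q : ℕ × ℕ => (v q.1 * w q.1 q.2) • x q.2 := by
    refine Summable.of_norm_bounded (hFs.mul_right M) fun q => ?_
    rw [norm_smul, Real.norm_of_nonneg (hF0 q)]
    exact mul_le_mul_of_nonneg_left (hM _) (hF0 q)
  have hF1 : HasSum (fun q : ℕ × ℕ => v q.1 * w q.1 q.2) 1 := by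
    have h := hFs.hasSum
    rwa [(h.prod_fiberwise hrow).unique hv1] at h
  obtain ⟨y, hG⟩ := hGs
  have hcol : ∀ n, HasSum (fun j => v j * w j n) (∑' j, v j * w j n) := fun n =>
    (((Equiv.prodComm ℕ ℕ).summable_iff.mpr hFs).prod_factor n).hasSum
  refine ⟨y, ⟨fun n => ∑' j, v j * w j n, fun n => tsum_nonneg fun j => hF0 (j, n),
    fun n hn => ?_, ?_, ?_⟩, ?_⟩
  · simp [hw _ n hn]
  · exact ((Equiv.prodComm ℕ ℕ).hasSum_iff.mpr hF1).prod_fiberwise hcol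
  · exact ((Equiv.prodComm ℕ ℕ).hasSum_iff.mpr hG).prod_fiberwise
      fun n => (hcol n).smul_const (x n)
  · refine hG.prod_fiberwise fun j => ?_
    simpa only [mul_smul] using (hy j).const_smul (v j)

theorem hasSum_half_pow_succ : HasSum (fun j : ℕ => ((1 : ℝ) / 2) ^ (j + 1)) 1 := by
  simpa [pow_succ'] using hasSum_geometric_two.mul_left ((1 : ℝ) / 2)

theorem hasSum_shift {V : Type*} [NormedAddCommGroup V] [NormedSpace ℝ V] {y : ℕ → V} {z r : V}
    (k : ℕ) (hr : HasSum (fun j => ((1 : ℝ) / 2) ^ (j + 1) • y (j + k)) r)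
    (hz : z = ∑ j ∈ Finset.range k, ((1 : ℝ) / 2) ^ (j + 1) • y j) :
    HasSum (fun j => ((1 : ℝ) / 2) ^ (j + 1) • y j) (z + ((1 : ℝ) / 2) ^ k • r) := by
  rw [hz, add_comm, ← hasSum_nat_add_iff k]
  convert hr.const_smul (((1 : ℝ) / 2) ^ k) using 2 with j
  rw [smul_smul, ← pow_add]
  ring_nf

/-- **Simons' inequality** for a bounded sequence `x` and a set of functionals on which every
infinite convex combination of `x` attains its supremum. -/
theorem simons_inequality [CompleteSpace E] {C : Set (StrongDual ℝ E)} {x : ℕ → E} {M : ℝ}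
    (hM : ∀ n, ‖x n‖ ≤ M) {p : E → ℝ} (hle : ∀ y ∈ sigmaConvexHull x, ∀ c ∈ C, c y ≤ p y)
    (hatt : ∀ y ∈ sigmaConvexHull x, ∃ c ∈ C, c y = p y) {m : ℝ}
    (hm : ∀ y ∈ sigmaConvexHull x, m ≤ p y) {δ : ℝ} (hδ : 0 < δ) :
    ∃ c ∈ C, ∀ k, ∃ n, k ≤ n ∧ m - 2 * δ ≤ c (x n) := by
  rw [← tailHull_zero] at *
  have hstep : ∀ (z : E) (k : ℕ), ∃ y ∈ tailHull x k,
      (∀ y' ∈ tailHull x k, m ≤ p (z + ((1 : ℝ) / 2) ^ k • y')) →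
      ∀ y' ∈ tailHull x k, p (z + ((1 : ℝ) / 2) ^ k • y) ≤
        p (z + ((1 : ℝ) / 2) ^ k • y') + δ * (1 / 2) ^ (k + 1) * (1 / 2) ^ k := fun z k =>
    exists_near_minimizer ⟨x k, mem_tailHull_self x k⟩ (fun y => p (z + ((1 : ℝ) / 2) ^ k • y))
      (by positivity)
  choose Y hYmem hYmin using hstep
  let z : ℕ → E := fun k => Nat.rec 0 (fun k z => z + ((1 : ℝ) / 2) ^ (k + 1) • Y z k) k
  set y : ℕ → E := fun k => Y (z k) k with hy
  have hz : ∀ k, z k = ∑ j ∈ Finset.range k, ((1 : ℝ) / 2) ^ (j + 1) • y j := by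
    intro k
    induction k with
    | zero => rfl
    | succ k ih => rw [Finset.sum_range_succ, ← ih]
  have hymem : ∀ k j, k ≤ j → y j ∈ tailHull x k := fun k j h =>
    tailHull_antitone x h (hYmem _ _)
  have hv : ∀ j : ℕ, (0 : ℝ) ≤ (1 / 2) ^ (j + 1) := fun j => by positivity
  have hzmem : ∀ k, ∀ y' ∈ tailHull x k, z k + ((1 : ℝ) / 2) ^ k • y' ∈ tailHull x 0 := by
    intro k y' hy'
    obtain ⟨q, hq, hqs⟩ := exists_hasSum_mem_tailHull hM (k := 0)
      (Y := fun j => if j < k then y j else y')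
      (fun j => by
        split_ifs
        · exact hymem 0 j (Nat.zero_le _)
        · exact tailHull_antitone x (Nat.zero_le k) hy') hv hasSum_half_pow_succ
    have h2 := hasSum_shift (y := fun j => if j < k then y j else y') (z := z k) (r := y') k
      (by simpa using hasSum_half_pow_succ.smul_const y')
      (by
        rw [hz]
        refine Finset.sum_congr rfl fun j hj => ?_
        simp [Finset.mem_range.mp hj])
    rwa [hqs.unique h2] at hq
  have hr : ∀ k, ∃ r ∈ tailHull x k, HasSum (fun j => ((1 : ℝ) / 2) ^ (j + 1) • y (j + k)) r :=
    fun k => exists_hasSum_mem_tailHull hM (fun j => hymem k _ (Nat.le_add_left _ _)) hv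
      hasSum_half_pow_succ
  choose r hrmem hrs using hr
  have hr0 : ∀ k, z k + ((1 : ℝ) / 2) ^ k • r k = r 0 := fun k =>
    (hasSum_shift k (hrs k) (hz k)).unique (hrs 0)
  obtain ⟨c, hc, hcp⟩ := hatt (r 0) (hrmem 0)
  refine ⟨c, hc, fun k => ?_⟩
  have hyr : ∀ k, c (y k) ≤ c (r k) + δ * (1 / 2) ^ (k + 1) := by
    intro k
    have h1 := hYmin (z k) k (fun y' hy' => hm _ (hzmem k y' hy')) (r k) (hrmem k)
    rw [hr0, ← hcp, ← hr0 k] at h1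
    have h2 := (hle _ (hzmem k (y k) (hymem k k le_rfl)) c hc).trans h1
    simp only [map_add, map_smul, smul_eq_mul] at h2
    have h3 : (0 : ℝ) < (1 / 2) ^ k := by positivity
    refine le_of_mul_le_mul_left ?_ h3
    linarith
  have hrr : ∀ k, c (r k) ≤ c (r (k + 1)) + δ * (1 / 2) ^ (k + 1) := by
    intro k
    have h1 : r k = (1 / 2 : ℝ) • y k + (1 / 2 : ℝ) • r (k + 1) := by
      have h := hasSum_shift (y := fun j => y (j + k)) (z := (1 / 2 : ℝ) • y k) (r := r (k + 1)) 1
        (by simpa only [add_assoc, add_comm 1 k] using hrs (k + 1)) (by simp)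
      rw [pow_one] at h
      exact (hrs k).unique h
    have h2 := congrArg c h1
    simp only [map_add, map_smul, smul_eq_mul] at h2
    linarith [hyr k]
  have hall : ∀ k, m - δ * (1 - (1 / 2) ^ k) ≤ c (r k) := by
    intro k
    induction k with
    | zero => simpa [hcp] using hm _ (hrmem 0)
    | succ k ih =>
      have := hrr k
      rw [pow_succ] at this ⊢
      linarith
  by_contra! hcon
  have h1 := le_of_mem_tailHull (hrmem k) c fun n hn => (hcon n hn).le
  have h2 := hall k
  have h3 : 0 < δ * (1 / 2) ^ k := by positivity
  linarith

theorem image_toWeakDual (S : Set (StrongDual ℝ E)) :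
    StrongDual.toWeakDual '' S = WeakDual.toStrongDual ⁻¹' S :=
  LinearEquiv.image_eq_preimage_symm _ _

theorem isWeakStarClosed_of_inter_le {S : Set (StrongDual ℝ E)} (hS : IsWeakStarClosed S)
    {ι : Type*} (t : ι → E) (a : ι → ℝ) : IsWeakStarClosed {c ∈ S | ∀ i, c (t i) ≤ a i} := by
  rw [IsWeakStarClosed, image_toWeakDual] at *
  have : WeakDual.toStrongDual ⁻¹' {c : StrongDual ℝ E | ∀ i, c (t i) ≤ a i} =
      ⋂ i, {f : WeakDual ℝ E | f (t i) ≤ a i} := by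
    ext f; simp
  refine hS.inter (this.symm ▸ isClosed_iInter fun i =>
    isClosed_le (WeakDual.eval_continuous (t i)) continuous_const :)

theorem IsWeakStarClosed.isWeakStarCompact {S : Set (StrongDual ℝ E)} (hS : IsWeakStarClosed S)
    {M : ℝ} (hM : ∀ c ∈ S, ‖c‖ ≤ M) : IsWeakStarCompact S := by
  rw [IsWeakStarClosed, image_toWeakDual] at hS
  rw [IsWeakStarCompact, image_toWeakDual]
  exact (WeakDual.isCompact_closedBall (0 : StrongDual ℝ E) M).of_isClosed_subset hS
    fun f hf => mem_closedBall_zero_iff.mpr (hM _ hf)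

theorem isWeakStarCompact_closedBall (c : StrongDual ℝ E) (r : ℝ) :
    IsWeakStarCompact (Metric.closedBall c r) := by
  rw [IsWeakStarCompact, image_toWeakDual]
  exact WeakDual.isCompact_closedBall c r

theorem IsWeakStarCompact.exists_isMaxOn {S : Set (StrongDual ℝ E)} (hS : IsWeakStarCompact S)
    (hne : S.Nonempty) (x : E) : ∃ c ∈ S, ∀ c' ∈ S, c' x ≤ c x := by
  obtain ⟨_, ⟨c, hc, rfl⟩, hmax⟩ := IsCompact.exists_isMaxOn hS (hne.image _)
    (WeakDual.eval_continuous x).continuousOn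
  exact ⟨c, hc, fun c' hc' => hmax ⟨c', hc', rfl⟩⟩

theorem IsWeakStarCompact.exists_bound {S : Set (StrongDual ℝ E)} (hS : IsWeakStarCompact S)
    (x : E) : ∃ M : ℝ, 0 ≤ M ∧ ∀ c ∈ S, c x ≤ M := by
  rcases S.eq_empty_or_nonempty with rfl | hne
  · exact ⟨0, le_rfl, by simp⟩
  · obtain ⟨c, -, h⟩ := hS.exists_isMaxOn hne x
    exact ⟨max 0 (c x), le_max_left _ _, fun c' hc' => (h c' hc').trans (le_max_right _ _)⟩

theorem exists_separating {S T : Set (StrongDual ℝ E)} (hS : IsWeakStarCompact S)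
    (hSc : Convex ℝ S) (hT : IsWeakStarClosed T) (hTc : Convex ℝ T) (hd : Disjoint S T) :
    ∃ (x : E) (a : ℝ), (∀ s ∈ S, a < s x) ∧ ∀ t ∈ T, t x < a := by
  have : LocallyConvexSpace ℝ (WeakDual ℝ E) := (WeakDual.withSeminorms ℝ E).toLocallyConvexSpace
  obtain ⟨φ, u, v, h1, huv, h2⟩ := geometric_hahn_banach_compact_closed
    (hSc.linear_image (StrongDual.toWeakDual (𝕜 := ℝ) (E := E)).toLinearMap) hS
    (hTc.linear_image (StrongDual.toWeakDual (𝕜 := ℝ) (E := E)).toLinearMap) hT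
    ((Set.disjoint_image_iff (StrongDual.toWeakDual (𝕜 := ℝ) (E := E)).injective).mpr hd)
  obtain ⟨x, hx⟩ := LinearMap.dualEmbedding_surjective (topDualPairing ℝ E) φ
  have hφ : ∀ f : StrongDual ℝ E, φ (StrongDual.toWeakDual f) = f x := fun f => by
    rw [← hx]; rfl
  refine ⟨-x, -u, fun s hs => ?_, fun t ht => ?_⟩
  · have := h1 _ ⟨s, hs, rfl⟩
    erw [hφ] at this
    simpa using this
  · have := h2 _ ⟨t, ht, rfl⟩
    erw [hφ] at this
    rw [map_neg]
    linarith

theorem mem_directions_iff {D : Set (StrongDual ℝ E)} (hD : IsWeakStarCompact D) {x : E} :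
    x ∈ directions D ↔ (∀ d ∈ D, d x < 0) ∧ (D = ∅ → x ≠ 0) := by
  constructor
  · rintro (⟨hne, h⟩ | ⟨rfl, h⟩)
    · refine ⟨fun d hd => ?_, fun h0 => absurd h0 hne.ne_empty⟩
      exact_mod_cast (le_iSup₂ (f := fun (f : StrongDual ℝ E) (_ : f ∈ D) =>
        ((f x : ℝ) : EReal)) d hd).trans_lt h
    · exact ⟨by simp, fun _ => h⟩
  · rintro ⟨h1, h2⟩
    rcases D.eq_empty_or_nonempty with rfl | hne
    · exact Or.inr ⟨rfl, h2 rfl⟩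
    · obtain ⟨d, hd, hmax⟩ := hD.exists_isMaxOn hne x
      refine Or.inl ⟨hne, lt_of_le_of_lt (b := ((d x : ℝ) : EReal)) ?_ ?_⟩
      · exact iSup₂_le fun c hc => by exact_mod_cast hmax c hc
      · exact_mod_cast h1 d hd

theorem convex_cone {D : Set (StrongDual ℝ E)} (hD : Convex ℝ D) : Convex ℝ (cone D) := by
  rw [convex_iff_forall_pos]
  have hsmul : ∀ g ∈ cone D, ∀ a : ℝ, 0 < a → a • g ∈ cone D := by
    rintro g (rfl | ⟨t, ht, f, hf, rfl⟩) a ha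
    · exact Or.inl (by simp)
    · exact Or.inr ⟨a * t, mul_pos ha ht, f, hf, smul_smul _ _ _⟩
  have hadd : ∀ g ∈ cone D, ∀ h ∈ cone D, g + h ∈ cone D := by
    rintro g (rfl | ⟨t, ht, f, hf, rfl⟩) h hh
    · simpa using hh
    · rcases hh with rfl | ⟨s, hs, e, he, rfl⟩
      · exact Or.inr ⟨t, ht, f, hf, by simp⟩
      · refine Or.inr ⟨t + s, add_pos ht hs, (t / (t + s)) • f + (s / (t + s)) • e,
          hD hf he (by positivity) (by positivity) (by field_simp), ?_⟩
        rw [smul_add, smul_smul, smul_smul]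
        congr 2 <;> field_simp
  intro g hg h hh a b ha hb _
  exact hadd _ (hsmul g hg a ha) _ (hsmul h hh b hb)

theorem isWeakStarClosed_cone {D : Set (StrongDual ℝ E)} (hD : IsWeakStarCompact D)
    (hDc : Convex ℝ D) (hD0 : (0 : StrongDual ℝ E) ∉ D) : IsWeakStarClosed (cone D) := by
  obtain ⟨u, a, ha, h0⟩ := exists_separating (T := {0}) hD hDc
    (by simp [IsWeakStarClosed]) (convex_singleton 0) (by simpa using hD0)
  replace h0 : 0 < a := by simpa using h0 0 rfl
  rw [IsWeakStarClosed]
  refine isClosed_of_closure_subset fun g hg => ?_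
  set T : ℝ := (|g u| + 1) / a with hT
  have hopen : IsOpen {f : WeakDual ℝ E | f u < |g u| + 1} :=
    isOpen_lt (WeakDual.eval_continuous u) continuous_const
  have hK : IsCompact ((fun q : ℝ × WeakDual ℝ E => q.1 • q.2) ''
      (Set.Icc 0 T ×ˢ (StrongDual.toWeakDual '' D)) ∪ {0}) :=
    ((isCompact_Icc.prod hD).image continuous_smul).union isCompact_singleton
  have hgK := closure_minimal (?_ : {f : WeakDual ℝ E | f u < |g u| + 1} ∩
    StrongDual.toWeakDual '' cone D ⊆ _) hK.isClosed
      (hopen.inter_closure ⟨(le_abs_self (g u)).trans_lt (lt_add_one _), hg⟩)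
  · rcases hgK with ⟨⟨t, _⟩, ⟨⟨ht, -⟩, f, hf, rfl⟩, rfl⟩ | rfl
    · rcases ht.eq_or_lt with h | h
      · exact ⟨0, Or.inl rfl, by simp [← show (0 : ℝ) = t from h]⟩
      · exact ⟨t • f, Or.inr ⟨t, h, f, hf, rfl⟩, by simp⟩
    · exact ⟨0, Or.inl rfl, by simp⟩
  · rintro _ ⟨hlt, f, rfl | ⟨t, ht, d, hd, rfl⟩, rfl⟩
    · exact Or.inr (by simp)
    · refine Or.inl ⟨(t, StrongDual.toWeakDual d), ⟨⟨ht.le, ?_⟩, d, hd, rfl⟩, by simp⟩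
      have h1 : t * d u < |g u| + 1 := hlt
      rw [hT, le_div_iff₀ h0]
      nlinarith [ha d hd]

theorem IsWeakStarCompact.isWeakStarClosed_add {K T : Set (StrongDual ℝ E)}
    (hK : IsWeakStarCompact K) (hT : IsWeakStarClosed T) : IsWeakStarClosed (K + T) := by
  rw [IsWeakStarClosed, Set.image_add]
  exact IsClosed.add_left_of_isCompact hT hK

theorem directions_nonempty {D : Set (StrongDual ℝ E)} (hD : IsWeakStarCompact D)
    (hDc : Convex ℝ D) (hD0 : (0 : StrongDual ℝ E) ∉ D) [Nontrivial E] :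
    (directions D).Nonempty := by
  rcases D.eq_empty_or_nonempty with rfl | hne
  · obtain ⟨x, hx⟩ := exists_ne (0 : E)
    exact ⟨x, Or.inr ⟨rfl, hx⟩⟩
  · obtain ⟨u, a, ha, h0⟩ := exists_separating (T := {0}) hD hDc
      (by simp [IsWeakStarClosed]) (convex_singleton 0) (by simpa using hD0)
    replace h0 : 0 < a := by simpa using h0 0 rfl
    refine ⟨-u, (mem_directions_iff hD).mpr ⟨fun d hd => ?_, fun h => absurd h hne.ne_empty⟩⟩
    have := ha d hd
    rw [map_neg]
    linarith

/-- A weak*-closed set that is bounded above at the points near `x` attains its supremum at `x`. -/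
theorem exists_isMaxOn_of_forall_bound [CompleteSpace E] {C D : Set (StrongDual ℝ E)}
    (hD : IsWeakStarCompact D) (hC : IsWeakStarClosed C) (hne : C.Nonempty)
    (hbd : ∀ x, (∀ d ∈ D, d x < 0) → ∃ M : ℝ, ∀ c ∈ C, c x ≤ M) {x : E}
    (hx : ∀ d ∈ D, d x < 0) : ∃ c ∈ C, ∀ c' ∈ C, c' x ≤ c x := by
  obtain ⟨e, he⟩ := hne
  set S : Set (StrongDual ℝ E) := {c ∈ C | ∀ _ : Unit, c (-x) ≤ -e x} with hSdef
  have hmemS : ∀ c ∈ C, e x ≤ c x → c ∈ S := fun c hc h => ⟨hc, fun _ => by simpa using h⟩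
  have hxS : ∀ c ∈ S, e x ≤ c x := fun c hc => by simpa using hc.2 ()
  have hdir : ∀ h : E, ∃ M : ℝ, ∀ c ∈ S, c h ≤ M := by
    intro h
    obtain ⟨t, ht, htd⟩ : ∃ t : ℝ, 0 < t ∧ ∀ d ∈ D, d (x + t • h) < 0 := by
      rcases D.eq_empty_or_nonempty with rfl | hDne
      · exact ⟨1, one_pos, by simp⟩
      · obtain ⟨d₀, hd₀, hmax⟩ := hD.exists_isMaxOn hDne x
        obtain ⟨M, hM0, hM⟩ := hD.exists_bound h
        have h0 := hx d₀ hd₀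
        refine ⟨-d₀ x / (2 * (M + 1)), by apply div_pos <;> linarith, fun d hd => ?_⟩
        have h1 : -d₀ x / (2 * (M + 1)) * d h ≤ -d₀ x / (2 * (M + 1)) * (M + 1) :=
          mul_le_mul_of_nonneg_left (by linarith [hM d hd]) (by apply div_nonneg <;> linarith)
        have h2 : -d₀ x / (2 * (M + 1)) * (M + 1) = -d₀ x / 2 := by field_simp
        rw [map_add, map_smul, smul_eq_mul]
        linarith [hmax d hd]
    obtain ⟨M, hM⟩ := hbd _ htd
    refine ⟨(M - e x) / t, fun c hc => ?_⟩
    have h1 := hM c hc.1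
    rw [map_add, map_smul, smul_eq_mul] at h1
    rw [le_div_iff₀ ht]
    linarith [hxS c hc]
  obtain ⟨M, hM⟩ := banach_steinhaus (g := fun c : S => (c : StrongDual ℝ E)) fun h => by
    obtain ⟨M₁, h₁⟩ := hdir h
    obtain ⟨M₂, h₂⟩ := hdir (-h)
    refine ⟨max M₁ M₂, fun c => abs_le.mpr ⟨?_, (h₁ c c.2).trans (le_max_left _ _)⟩⟩
    have := (h₂ c c.2).trans (le_max_right M₁ M₂)
    rw [map_neg] at this
    linarith
  have hS : IsWeakStarCompact S :=
    (isWeakStarClosed_of_inter_le hC _ _).isWeakStarCompact fun c hc => hM ⟨c, hc⟩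
  obtain ⟨c, hc, hmax⟩ := hS.exists_isMaxOn ⟨e, hmemS e he le_rfl⟩ x
  refine ⟨c, hc.1, fun c' hc' => ?_⟩
  rcases le_total (e x) (c' x) with h | h
  · exact hmax c' (hmemS c' hc' h)
  · exact h.trans (hxS c hc)

theorem supLimsup_mono (x : ℕ → E) {B C : Set (StrongDual ℝ E)} (h : B ⊆ C) :
    supLimsup x B ≤ supLimsup x C :=
  biSup_mono fun _ hf => h hf

theorem exists_bound_of_supOn_lt_top {C D : Set (StrongDual ℝ E)} (hD : IsWeakStarCompact D)
    (hCsup : ∀ x ∈ directions D, supOn x C < ⊤) (x : E) (hx : ∀ d ∈ D, d x < 0) :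
    ∃ M : ℝ, ∀ c ∈ C, c x ≤ M := by
  by_cases h0 : x = 0
  · exact ⟨0, fun c _ => by simp [h0]⟩
  · obtain ⟨M, hM, -⟩ := EReal.lt_iff_exists_real_btwn.mp
      (hCsup x ((mem_directions_iff hD).mpr ⟨hx, fun _ => h0⟩))
    refine ⟨M, fun c hc => ?_⟩
    exact_mod_cast (le_iSup₂ (f := fun (f : StrongDual ℝ E) (_ : f ∈ C) =>
      ((f x : ℝ) : EReal)) c hc).trans hM.le

theorem exists_norm_bound_of_isBounded_range {V : Type*} [NormedAddCommGroup V] {x : ℕ → V}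
    (h : Bornology.IsBounded (Set.range x)) :
    ∃ M : ℝ, 0 ≤ M ∧ ∀ n, ‖x n‖ ≤ M := by
  obtain ⟨M, hM⟩ := h.exists_norm_le
  exact ⟨M, (norm_nonneg _).trans (hM (x 0) ⟨0, rfl⟩), fun n => hM _ ⟨n, rfl⟩⟩

/-- Simons' inequality for a weak*-closed set that is bounded above at the points of `L_D`. -/
theorem iInf_supOn_le_supLimsup [CompleteSpace E] {C D : Set (StrongDual ℝ E)}
    (hD : IsWeakStarCompact D) (hC : IsWeakStarClosed C)
    (hCsup : ∀ x ∈ directions D, supOn x C < ⊤) {x : ℕ → E} (hx : ∀ n, x n ∈ directions D)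
    (hbd : Bornology.IsBounded (Set.range x)) :
    ⨅ y ∈ sigmaConvexHull x, supOn y C ≤ supLimsup x C := by
  rcases C.eq_empty_or_nonempty with rfl | hne
  · refine (iInf₂_le (x 0) ?_).trans (by simp [supOn])
    rw [← tailHull_zero]
    exact mem_tailHull_self x 0
  obtain ⟨M, -, hM⟩ := exists_norm_bound_of_isBounded_range hbd
  have hatt : ∀ y ∈ sigmaConvexHull x, ∃ c ∈ C, ∀ c' ∈ C, c' y ≤ c y := fun y hy =>
    exists_isMaxOn_of_forall_bound hD hC hne (exists_bound_of_supOn_lt_top hD hCsup)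
      fun d hd => neg_of_mem_sigmaConvexHull hy d fun n => ((mem_directions_iff hD).mp (hx n)).1 d hd
  choose! s hsC hs using hatt
  rw [← EReal.ge_of_forall_gt_iff_ge]
  intro m hm
  obtain ⟨m', hmm', hm'⟩ := EReal.lt_iff_exists_real_btwn.mp hm
  have hmm' : m < m' := by exact_mod_cast hmm'
  obtain ⟨c, hc, hfreq⟩ := simons_inequality (C := C) hM (p := fun y => s y y) (m := m')
    (δ := (m' - m) / 2) hs (fun y hy => ⟨s y, hsC y hy, rfl⟩)
    (fun y hy => by
      have h1 := hm'.le.trans (iInf₂_le y hy)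
      have h2 : supOn y C ≤ ((s y y : ℝ) : EReal) :=
        iSup₂_le fun c hc => by exact_mod_cast hs y hy c hc
      exact_mod_cast h1.trans h2)
    (by linarith)
  refine le_trans ?_ (le_iSup₂ (f := fun (f : StrongDual ℝ E) (_ : f ∈ C) =>
    limsup (fun n => ((f (x n) : ℝ) : EReal)) atTop) c hc)
  refine le_limsup_of_frequently_le (frequently_atTop.mpr fun k => ?_)
  obtain ⟨n, hn, h⟩ := hfreq k
  refine ⟨n, hn, ?_⟩
  exact_mod_cast (by linarith : m ≤ c (x n))

theorem apply_nonpos_of_mem_cone {D : Set (StrongDual ℝ E)} {x : E} (hx : ∀ d ∈ D, d x < 0)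
    {g : StrongDual ℝ E} (hg : g ∈ cone D) : g x ≤ 0 := by
  rcases hg with rfl | ⟨t, ht, d, hd, rfl⟩
  · simp
  · simpa using mul_nonpos_of_nonneg_of_nonpos ht.le (hx d hd).le

/-- The functionals in `C` of norm at most `n` that are bounded by `α` on the `n`-th tail
of `x`. -/
def tailBounded (C : Set (StrongDual ℝ E)) (x : ℕ → E) (α : ℝ) (n : ℕ) : Set (StrongDual ℝ E) :=
  {c ∈ {c ∈ C | ∀ m : {m // n ≤ m}, c (x m) ≤ α} | ∀ y, c y ≤ n * ‖y‖}

theorem tailBounded_mono (C : Set (StrongDual ℝ E)) (x : ℕ → E) (α : ℝ) :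
    Monotone (tailBounded C x α) := by
  rintro n n' hn c ⟨⟨hc, h1⟩, h2⟩
  refine ⟨⟨hc, fun m => h1 ⟨m, hn.trans m.2⟩⟩, fun y => (h2 y).trans ?_⟩
  gcongr

theorem isWeakStarCompact_tailBounded {C : Set (StrongDual ℝ E)} (hC : IsWeakStarClosed C)
    (x : ℕ → E) (α : ℝ) (n : ℕ) : IsWeakStarCompact (tailBounded C x α n) := by
  refine (isWeakStarClosed_of_inter_le (isWeakStarClosed_of_inter_le hC _ _) _
    _).isWeakStarCompact (M := n) fun c hc => c.opNorm_le_bound n.cast_nonneg fun y => ?_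
  refine abs_le.mpr ⟨?_, hc.2 y⟩
  have := hc.2 (-y)
  rw [map_neg, norm_neg] at this
  linarith

theorem convex_tailBounded {C : Set (StrongDual ℝ E)} (hC : Convex ℝ C)
    (x : ℕ → E) (α : ℝ) (n : ℕ) : Convex ℝ (tailBounded C x α n) := by
  rintro c ⟨⟨hc, h1⟩, h2⟩ e ⟨⟨he, h3⟩, h4⟩ a b ha hb hab
  have key : ∀ (y : E) (r : ℝ), c y ≤ r → e y ≤ r → (a • c + b • e) y ≤ r := fun y r hr hr' =>
    calc a * c y + b * e y ≤ a * r + b * r := by gcongr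
      _ = r := by rw [← add_mul, hab, one_mul]
  exact ⟨⟨hC hc he ha hb hab, fun m => key _ _ (h1 m) (h3 m)⟩, fun y => key _ _ (h2 y) (h4 y)⟩

theorem supLimsup_le_of_subset_closure {B C D : Set (StrongDual ℝ E)}
    (hD : IsWeakStarCompact D) (hC : IsWeakStarClosed C) (hCconv : Convex ℝ C) (hBC : B ⊆ C)
    (h : ∀ K : ℕ → Set (StrongDual ℝ E), Monotone K →
      (∀ n, IsWeakStarCompact (K n) ∧ Convex ℝ (K n) ∧ K n ⊆ C) →
      B ⊆ ⋃ n, K n → C ⊆ closure ((⋃ n, K n) + cone D))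
    {x : ℕ → E} (hx : ∀ n, x n ∈ directions D) (hbd : Bornology.IsBounded (Set.range x)) :
    supLimsup x C ≤ supLimsup x B := by
  obtain ⟨M, hM0, hM⟩ := exists_norm_bound_of_isBounded_range hbd
  rw [← EReal.le_of_forall_lt_iff_le]
  intro α hα
  have hcov := h (tailBounded C x α) (tailBounded_mono C x α)
    (fun n => ⟨isWeakStarCompact_tailBounded hC x α n, convex_tailBounded hCconv x α n,
      fun c hc => hc.1.1⟩)
    (fun b hb => by
      have hlt := (le_iSup₂ (f := fun (f : StrongDual ℝ E) (_ : f ∈ B) =>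
        limsup (fun n => ((f (x n) : ℝ) : EReal)) atTop) b hb).trans_lt hα
      obtain ⟨N, hN⟩ := eventually_atTop.mp (eventually_lt_of_limsup_lt hlt)
      obtain ⟨N', hN'⟩ := exists_nat_ge ‖b‖
      refine Set.mem_iUnion.mpr ⟨max N N', ⟨hBC hb, fun m => ?_⟩, fun y => ?_⟩
      · exact_mod_cast (hN m ((le_max_left _ _).trans m.2)).le
      · refine (le_abs_self _).trans ((b.le_opNorm y).trans ?_)
        gcongr
        exact hN'.trans (by exact_mod_cast le_max_right N N'))
  refine iSup₂_le fun c hc => ?_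
  rw [← EReal.le_of_forall_lt_iff_le]
  intro β hβ
  have hβ : α < β := by exact_mod_cast hβ
  obtain ⟨f, hf, hdist⟩ := Metric.mem_closure_iff.mp (hcov hc) ((β - α) / (M + 1))
    (div_pos (by linarith) (by linarith))
  obtain ⟨k, hk, g, hg, rfl⟩ := hf
  obtain ⟨n, hkn⟩ := Set.mem_iUnion.mp hk
  refine limsup_le_of_le (h := eventually_atTop.mpr ⟨n, fun m hm => ?_⟩)
  have h1 := hkn.1.2 ⟨m, hm⟩
  have h2 := apply_nonpos_of_mem_cone ((mem_directions_iff hD).mp (hx m)).1 hg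
  have h3 := (le_abs_self _).trans ((c - (k + g)).le_opNorm (x m))
  have h4 : ‖c - (k + g)‖ * ‖x m‖ ≤ (β - α) / (M + 1) * (M + 1) :=
    mul_le_mul (dist_eq_norm c (k + g) ▸ hdist.le) (by linarith [hM m]) (norm_nonneg _)
      (div_nonneg (by linarith) (by linarith))
  rw [div_mul_cancel₀ _ (by linarith)] at h4
  simp only [sub_apply, add_apply] at h3
  exact_mod_cast (by linarith : c (x m) ≤ β)

/-- A functional at positive distance from `K + cone D` is strictly separated from `K` by a
direction in `L_D` of controlled norm. -/
theorem exists_direction_separating {K D : Set (StrongDual ℝ E)} (hD : IsWeakStarCompact D)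
    (hDc : Convex ℝ D) (hD0 : (0 : StrongDual ℝ E) ∉ D) (hK : IsWeakStarCompact K)
    (hKc : Convex ℝ K) {c : StrongDual ℝ E} {δ : ℝ} (hδ : 0 < δ)
    (hsep : ∀ f ∈ K + cone D, δ < dist c f) {u : E} (hu : u ∈ directions D) :
    ∃ x ∈ directions D, ‖x‖ ≤ 2 + ‖u‖ ∧ ∀ k ∈ K, k x ≤ c x - δ / 2 := by
  rcases K.eq_empty_or_nonempty with rfl | ⟨k₀, hk₀⟩
  · exact ⟨u, hu, by linarith [norm_nonneg u], by simp⟩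
  have hzero : (0 : StrongDual ℝ E) ∈ cone D := Or.inl rfl
  obtain ⟨x, a, hxa, hax⟩ := exists_separating (isWeakStarCompact_closedBall c δ)
    (convex_closedBall c δ) (hK.isWeakStarClosed_add (isWeakStarClosed_cone hD hDc hD0))
    (hKc.add (convex_cone hDc)) (Set.disjoint_left.mpr fun f hf hf' =>
      absurd (hsep f hf') (not_lt.mpr (Metric.mem_closedBall'.mp hf)))
  have hKa : ∀ k ∈ K, k x < a := fun k hk => hax k ⟨k, hk, 0, hzero, by simp⟩
  have hDx : ∀ d ∈ D, d x ≤ 0 := by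
    intro d hd
    by_contra! hpos
    have h1 := hax (k₀ + ((|a - k₀ x| + 1) / d x) • d)
      ⟨k₀, hk₀, _, Or.inr ⟨_, by positivity, d, hd, rfl⟩, rfl⟩
    have h2 : (k₀ + ((|a - k₀ x| + 1) / d x) • d) x = k₀ x + (|a - k₀ x| + 1) := by
      simp [hpos.ne']
    rw [h2] at h1
    linarith [le_abs_self (a - k₀ x)]
  have hnorm : a ≤ c x - δ * ‖x‖ := by
    obtain ⟨f, hf, hfx⟩ := exists_dual_vector'' ℝ x
    have := hxa (c - δ • f) (by
      rw [Metric.mem_closedBall, dist_eq_norm, sub_sub_cancel_left, norm_neg, norm_smul,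
        Real.norm_of_nonneg hδ.le]
      exact mul_le_of_le_one_right hδ.le hf)
    simp only [sub_apply, smul_apply, hfx,
      smul_eq_mul] at this
    exact this.le
  have hx0 : 0 < ‖x‖ := by
    refine norm_pos_iff.mpr fun h => ?_
    have h1 := hxa c (Metric.mem_closedBall_self hδ.le)
    have h2 := hKa k₀ hk₀
    simp only [h, map_zero] at h1 h2
    exact lt_asymm h1 h2
  set y : E := ‖x‖⁻¹ • x with hy
  have hy1 : ‖y‖ = 1 := by rw [hy, norm_smul, norm_inv, norm_norm, inv_mul_cancel₀ hx0.ne']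
  have hKy : ∀ k ∈ K, k y ≤ c y - δ := by
    intro k hk
    have h1 := mul_le_mul_of_nonneg_left ((hKa k hk).le.trans hnorm) (inv_nonneg.mpr hx0.le)
    rw [mul_sub, mul_left_comm, inv_mul_cancel₀ hx0.ne', mul_one] at h1
    simpa [hy] using h1
  obtain ⟨M, hM0, hM⟩ := hK.exists_bound u
  set A : ℝ := 2 * (M + |c u|) + 2 * δ * ‖u‖ + δ with hA
  have hA0 : 0 < A := by positivity
  set η : ℝ := δ / A with hη
  have hη0 : 0 < η := div_pos hδ hA0
  have hηA : η * A = δ := div_mul_cancel₀ δ hA0.ne'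
  have hηle : η * (M + |c u|) ≤ δ / 2 := by
    have h1 : 0 ≤ η * (2 * δ * ‖u‖ + δ) := by positivity
    rw [hA] at hηA
    linarith
  have hηu : η * ‖u‖ < 1 := by
    have h1 : 0 ≤ η * (2 * (M + |c u|)) := by positivity
    have h2 : 0 ≤ η * δ := by positivity
    have h3 : δ * (2 * (η * ‖u‖)) ≤ δ * 1 := by
      rw [hA] at hηA
      linarith
    linarith [le_of_mul_le_mul_left h3 hδ]
  have hu' := (mem_directions_iff hD).mp hu
  have hnu : ‖η • u‖ = η * ‖u‖ := by rw [norm_smul, Real.norm_of_nonneg hη0.le]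
  refine ⟨y + η • u, (mem_directions_iff hD).mpr ⟨fun d hd => ?_, fun _ h0 => ?_⟩, ?_,
    fun k hk => ?_⟩
  · have h1 : d y ≤ 0 := by
      rw [hy, map_smul, smul_eq_mul]
      exact mul_nonpos_of_nonneg_of_nonpos (inv_nonneg.mpr hx0.le) (hDx d hd)
    have h2 := mul_neg_of_pos_of_neg hη0 (hu'.1 d hd)
    rw [map_add, map_smul d η u, smul_eq_mul]
    linarith
  · rw [eq_neg_of_add_eq_zero_left h0, norm_neg, hnu] at hy1
    linarith
  · linarith [norm_add_le y (η • u), norm_nonneg u]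
  · have h1 := mul_le_mul_of_nonneg_left (hM k hk) hη0.le
    have h2 := mul_le_mul_of_nonneg_left (neg_abs_le (c u)) hη0.le
    simp only [map_add, map_smul, smul_eq_mul]
    linarith [hKy k hk]

theorem subset_closure_of_iInf_supOn_le {B C D : Set (StrongDual ℝ E)}
    (hD : IsWeakStarCompact D) (hDc : Convex ℝ D) (hD0 : (0 : StrongDual ℝ E) ∉ D)
    (hne : B.Nonempty ∨ Nontrivial E)
    (h : ∀ x : ℕ → E, (∀ n, x n ∈ directions D) → Bornology.IsBounded (Set.range x) →
      supLimsup x B ≥ ⨅ y ∈ sigmaConvexHull x, supOn y C)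
    {K : ℕ → Set (StrongDual ℝ E)} (hKm : Monotone K)
    (hK : ∀ n, IsWeakStarCompact (K n) ∧ Convex ℝ (K n)) (hBK : B ⊆ ⋃ n, K n) :
    C ⊆ closure ((⋃ n, K n) + cone D) := by
  intro c hc
  by_contra hcl
  have hnt : Nontrivial E := by
    rcases hne with ⟨b, hb⟩ | hnt
    · by_contra hE
      rw [not_nontrivial_iff_subsingleton] at hE
      exact hcl (subset_closure ⟨b, hBK hb, 0, Or.inl rfl, ContinuousLinearMap.ext fun x => by
        simp [Subsingleton.elim x 0]⟩)
    · exact hnt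
  obtain ⟨u, hu⟩ := directions_nonempty hD hDc hD0
  rw [Metric.mem_closure_iff] at hcl
  push Not at hcl
  obtain ⟨ε, hε, hdist⟩ := hcl
  have hx : ∀ n, ∃ x ∈ directions D, ‖x‖ ≤ 2 + ‖u‖ ∧ ∀ k ∈ K n, k x ≤ c x - ε / 2 / 2 :=
    fun n => exists_direction_separating hD hDc hD0 (hK n).1 (hK n).2 (half_pos hε)
      (fun f hf => (half_lt_self hε).trans_le
        (hdist f (Set.add_subset_add_right (Set.subset_iUnion K n) hf))) hu
  choose x hxD hxn hxK using hx
  obtain ⟨γ, -, φ, hφ, hγ⟩ := (isCompact_closedBall (0 : ℝ) (‖c‖ * (2 + ‖u‖))).tendsto_subseq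
    (x := fun n => c (x n)) fun n => mem_closedBall_zero_iff.mpr
      ((c.le_opNorm (x n)).trans (mul_le_mul_of_nonneg_left (hxn n) (norm_nonneg c)))
  obtain ⟨N, hN⟩ := Metric.tendsto_atTop.mp hγ (ε / 16) (by positivity)
  have hN' : ∀ n, |c (x (φ (n + N))) - γ| < ε / 16 := fun n => hN (n + N) (Nat.le_add_left _ _)
  have hge := h (fun n => x (φ (n + N))) (fun n => hxD _)
    (isBounded_iff_forall_norm_le.mpr ⟨2 + ‖u‖, by rintro _ ⟨n, rfl⟩; exact hxn _⟩)
  have hlow : ((γ - ε / 16 : ℝ) : EReal) ≤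
      ⨅ y ∈ sigmaConvexHull fun n => x (φ (n + N)), supOn y C := by
    refine le_iInf₂ fun y hy => le_trans ?_ (le_iSup₂ (f := fun (f : StrongDual ℝ E)
      (_ : f ∈ C) => ((f y : ℝ) : EReal)) c hc)
    rw [← tailHull_zero] at hy
    have := le_of_mem_tailHull hy (-c) (a := -(γ - ε / 16)) fun n _ => by
      have := (abs_lt.mp (hN' n)).1
      rw [neg_apply]
      linarith
    rw [neg_apply] at this
    exact_mod_cast neg_le_neg_iff.mp this
  have hupp : supLimsup (fun n => x (φ (n + N))) B ≤ ((γ + ε / 16 - ε / 4 : ℝ) : EReal) := by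
    refine iSup₂_le fun b hb => ?_
    obtain ⟨n₀, hn₀⟩ := Set.mem_iUnion.mp (hBK hb)
    refine limsup_le_of_le (h := eventually_atTop.mpr ⟨n₀, fun n hn => ?_⟩)
    have h1 := hxK _ b (hKm (hn.trans ((Nat.le_add_right n N).trans (hφ.le_apply))) hn₀)
    have h2 := (abs_lt.mp (hN' n)).2
    exact_mod_cast (by linarith : b (x (φ (n + N))) ≤ γ + ε / 16 - ε / 4)
  have hfin := hlow.trans (hge.trans hupp)
  have hfin' : γ - ε / 16 ≤ γ + ε / 16 - ε / 4 := by exact_mod_cast hfin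
  linarith

end OneSide
end

theorem mainTheorem6 {E : Type*} [NormedAddCommGroup E] [NormedSpace ℝ E] [CompleteSpace E]
    (B C D : Set (StrongDual ℝ E))
    (hD : OneSide.IsWeakStarCompact D) (hDconv : Convex ℝ D) (hD0 : (0 : StrongDual ℝ E) ∉ D)
    (hC : OneSide.IsWeakStarClosed C) (hCconv : Convex ℝ C)
    (hCsup : ∀ x ∈ OneSide.directions D, OneSide.supOn x C < ⊤)
    (hBC : B ⊆ C) (hne : B.Nonempty ∨ Nontrivial E) :
    List.TFAE [
      ∀ K : ℕ → Set (StrongDual ℝ E), Monotone K →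
        (∀ n, OneSide.IsWeakStarCompact (K n) ∧ Convex ℝ (K n) ∧ K n ⊆ C) →
        B ⊆ ⋃ n, K n → C ⊆ closure ((⋃ n, K n) + OneSide.cone D),
      ∀ x : ℕ → E, (∀ n, x n ∈ OneSide.directions D) → Bornology.IsBounded (Set.range x) →
        OneSide.supLimsup x B = OneSide.supLimsup x C,
      ∀ x : ℕ → E, (∀ n, x n ∈ OneSide.directions D) → Bornology.IsBounded (Set.range x) →
        OneSide.supLimsup x B ≥ ⨅ y ∈ OneSide.sigmaConvexHull x, OneSide.supOn y C] := by
  tfae_have 1 → 2 := fun h x hx hbd => le_antisymm (OneSide.supLimsup_mono x hBC)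
    (OneSide.supLimsup_le_of_subset_closure hD hC hCconv hBC h hx hbd)
  tfae_have 2 → 3 := fun h x hx hbd =>
    (OneSide.iInf_supOn_le_supLimsup hD hC hCsup hx hbd).trans (h x hx hbd).ge
  tfae_have 3 → 1 := fun h K hKm hK hBK =>
    OneSide.subset_closure_of_iInf_supOn_le hD hDconv hD0 hne h hKm
      (fun n => ⟨(hK n).1, (hK n).2.1⟩) hBK
  tfae_finish
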